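/- A graph is finite, with no loops or parallel edges; it is claw-free if it has no induced subgraph isomorphic to $K_{1,3}$, and cubic if every vertex has degree $3$. A cutedge is an edge whose deletion increases the number of connected components. \textbf{Theorem.} Let $n \ge 1$. Every (not necessarily connected) claw-free cubic graph on $n$ vertices with no cutedge has more than $2^{n/12}$ perfect matchings. -/

import Mathlib

/-- A graph is claw-free if it has no induced subgraph isomorphic to `K_{1,3}`. -/
def SimpleGraph.ClawFree {V : Type*} (G : SimpleGraph V) : Prop :=
  ¬ (completeBipartiteGraph (Fin 1) (Fin 3)).IsIndContained G

/-- No edge of the graph is a cutedge (bridge); the graph may be disconnected. -/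
def SimpleGraph.NoCutedge {V : Type*} (G : SimpleGraph V) : Prop :=
  ∀ e ∈ G.edgeSet, ¬ G.IsBridge e

/-- The number of perfect matchings of a graph. -/
noncomputable def SimpleGraph.numPerfectMatchings {V : Type*} (G : SimpleGraph V) : ℕ :=
  {M : G.Subgraph | M.IsPerfectMatching}.ncard

/-!
In a claw-free cubic graph every vertex lies in a triangle, and two triangles with a common vertex
share an edge. Hence the vertices fall into *blocks*, each of which is either a triangle or a
diamond, that is, a 4-cycle with a chord (`ClawFree.exists_block_partition`). The edges outside the
3-cycles and 4-cycles of the blocks form a perfect matching `σ`, which contains the chord of each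
diamond; a 4-clique counts as a diamond, one of whose tips is matched by `σ` to the other.

Contract each block, and let `z` be an even set of edges of `σ`, chords excluded, in the contracted
multigraph. Give up the edges of `z` and the chords of the diamonds met by `z`. The uncovered
vertices can be rematched inside each block: in a triangle in a unique way, and in a diamond along
its 4-cycle, in two ways. So with `t` triangles and `d` diamonds, if `u z` denotes the number of diamonds met by `z`, there are at least `∑ z, 2 ^ u z`
perfect matchings (`IsBlockMatching.sum_two_pow_le`). The even sets form a vector space over `ZMod 2`
of dimension at least `t / 2`
(`IsBlockMatching.card_le_two_mul_finrank_evenSpace`). Since no edge is a cutedge, each diamond is met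
by some even set (`IsBlockMatching.exists_mem_evenSpace_eq_one`), and hence by exactly half of them,
so that the average of `u` is `d / 2`. By Jensen's inequality there are at least
`2 ^ (t / 2 + d / 2)` perfect matchings, while the graph has `3 * t + 4 * d` vertices.
-/

open SimpleGraph

/-! ### Triangles and diamonds in claw-free cubic graphs -/

namespace SimpleGraph

universe u

variable {V : Type*} {G : SimpleGraph V}

theorem IsRegularOfDegree.exists_third_neighbor [G.LocallyFinite] (h : G.IsRegularOfDegree 3)
    {v p q : V} (hp : G.Adj v p) (hq : G.Adj v q) (hpq : p ≠ q) :
    ∃ w, G.Adj v w ∧ w ≠ p ∧ w ≠ q ∧ ∀ x, G.Adj v x → x = p ∨ x = q ∨ x = w := by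
  classical
  obtain ⟨a, b, c, hab, hac, hbc, hs⟩ := Finset.card_eq_three.1 (h v)
  have key : ∀ x, G.Adj v x ↔ x = a ∨ x = b ∨ x = c := fun x => by
    rw [← mem_neighborFinset, hs]; simp
  rw [key] at hp hq
  obtain ⟨w, hw, hwp, hwq⟩ : ∃ w, (w = a ∨ w = b ∨ w = c) ∧ w ≠ p ∧ w ≠ q := by
    by_cases h1 : a ≠ p ∧ a ≠ q
    · exact ⟨a, by grind⟩
    by_cases h2 : b ≠ p ∧ b ≠ q
    · exact ⟨b, by grind⟩
    · exact ⟨c, by grind⟩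
  exact ⟨w, (key w).2 hw, hwp, hwq, fun x hx => by rw [key] at hx; grind⟩

theorem IsRegularOfDegree.eq_of_adj [G.LocallyFinite] (h : G.IsRegularOfDegree 3)
    {v p q r x : V} (hp : G.Adj v p) (hq : G.Adj v q) (hr : G.Adj v r) (hpq : p ≠ q)
    (hpr : p ≠ r) (hqr : q ≠ r) (hx : G.Adj v x) : x = p ∨ x = q ∨ x = r := by
  obtain ⟨w, -, -, -, hw⟩ := h.exists_third_neighbor hp hq hpq
  have := hw x hx
  have := hw r hr
  grind

theorem ClawFree.exists_triangle [G.LocallyFinite] (hc : G.ClawFree)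
    (h : G.IsRegularOfDegree 3) (v : V) : ∃ p q, G.Adj v p ∧ G.Adj v q ∧ G.Adj p q := by
  classical
  obtain ⟨a, b, c, hab, hac, hbc, hs⟩ := Finset.card_eq_three.1 (h v)
  have key : ∀ x, G.Adj v x ↔ x = a ∨ x = b ∨ x = c := fun x => by
    rw [← mem_neighborFinset, hs]; simp
  have ha := (key a).2 (by simp)
  have hb := (key b).2 (by simp)
  have hc' := (key c).2 (by simp)
  by_contra! hno
  refine hc ⟨⟨⟨Sum.elim (fun _ => v) ![a, b, c], ?_⟩, ?_⟩⟩
  · rintro (i | i) (j | j) hij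
    · congr 1; exact Subsingleton.elim _ _
    · fin_cases j <;> simp at hij <;> subst hij <;> simp_all
    · fin_cases i <;> simp at hij <;> subst hij <;> simp_all
    · fin_cases i <;> fin_cases j <;> simp_all
  · intro i j
    change G.Adj (Sum.elim (fun _ => v) ![a, b, c] i) (Sum.elim (fun _ => v) ![a, b, c] j) ↔ _
    rcases i with i | i <;> rcases j with j | j
    · simp
    · fin_cases j <;> simp [ha, hb, hc']
    · fin_cases i <;> simp [ha.symm, hb.symm, hc'.symm]
    · fin_cases i <;> fin_cases j <;>
        simp [hno a b ha hb, hno a c ha hc', hno b c hb hc', hno b a hb ha, hno c a hc' ha,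
          hno c b hc' hb]

/-- The four vertices of a diamond, that is, of a 4-cycle `a b c d` with the chord `b d`. The
vertices `a` and `c` may be adjacent as well, so that a 4-clique is a diamond. -/
def IsDiamond [DecidableEq V] (G : SimpleGraph V) (s : Finset V) : Prop :=
  ∃ a b c d, G.Adj a b ∧ G.Adj b c ∧ G.Adj c d ∧ G.Adj d a ∧ G.Adj b d ∧ a ≠ c ∧
    s = {a, b, c, d}

variable [DecidableEq V] [G.LocallyFinite]

/-- Two triangles with a common vertex share an edge, as that vertex has only three neighbours. -/
theorem IsRegularOfDegree.eq_or_diamond_of_triangles (h : G.IsRegularOfDegree 3)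
    {s t : Finset V} (hs : G.IsNClique 3 s) (ht : G.IsNClique 3 t) {v : V} (hvs : v ∈ s)
    (hvt : v ∈ t) : s = t ∨ ∃ d, G.IsDiamond d ∧ s ⊆ d := by
  -- a clique of size three through `v`, written with `v` first
  have aux : ∀ {u : Finset V}, G.IsNClique 3 u → v ∈ u →
      ∃ p q, G.Adj v p ∧ G.Adj v q ∧ G.Adj p q ∧ u = {v, p, q} := by
    intro u hu hv
    obtain ⟨a, b, c, hab, hac, hbc, rfl⟩ := is3Clique_iff.1 hu
    simp only [Finset.mem_insert, Finset.mem_singleton] at hv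
    rcases hv with rfl | rfl | rfl
    · exact ⟨b, c, hab, hac, hbc, rfl⟩
    · exact ⟨a, c, hab.symm, hbc, hac, by grind⟩
    · exact ⟨a, b, hac.symm, hbc.symm, hab, by grind⟩
  obtain ⟨p, q, hp, hq, hpq, rfl⟩ := aux hs hvs
  obtain ⟨p', q', hp', hq', hpq', rfl⟩ := aux ht hvt
  obtain ⟨w, hw, hwp, hwq, hall⟩ := h.exists_third_neighbor hp hq hpq.ne
  have hne := hpq'.ne
  by_cases hpw : G.Adj p w
  · exact .inr ⟨{q, v, w, p}, ⟨q, v, w, p, hq.symm, hw, hpw.symm, hpq, hp, hwq.symm, rfl⟩,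
      by grind⟩
  by_cases hqw : G.Adj q w
  · exact .inr ⟨{p, v, w, q}, ⟨p, v, w, q, hp.symm, hw, hqw.symm, hpq.symm, hq, hwp.symm, rfl⟩,
      by grind⟩
  have h1 := hall _ hp'
  have h2 := hall _ hq'
  have h3 : ¬ G.Adj w p := fun h => hpw h.symm
  have h4 : ¬ G.Adj w q := fun h => hqw h.symm
  left
  grind

theorem IsRegularOfDegree.triangle_subset_diamond (h : G.IsRegularOfDegree 3)
    {s t : Finset V} (hs : G.IsDiamond s) (ht : G.IsNClique 3 t) {v : V} (hvs : v ∈ s)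
    (hvt : v ∈ t) : t ⊆ s := by
  obtain ⟨a, b, c, d, hab, hbc, hcd, hda, hbd, hac, rfl⟩ := hs
  have hcl : ∀ x ∈ t, ∀ y ∈ t, x ≠ y → G.Adj x y := fun x hx y hy hxy =>
    ht.isClique (by simpa using hx) (by simpa using hy) hxy
  -- all neighbours of an end of the chord lie in the diamond
  have hb : b ∈ t → t ⊆ {a, b, c, d} := by
    intro hb x hx
    by_cases hxb : x = b
    · grind
    have := h.eq_of_adj hab.symm hbc hbd hac hda.ne' hcd.ne (hcl b hb x hx (Ne.symm hxb))
    grind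
  have hd : d ∈ t → t ⊆ {a, b, c, d} := by
    intro hd x hx
    by_cases hxd : x = d
    · grind
    have := h.eq_of_adj hda hcd.symm hbd.symm hac hab.ne hbc.ne' (hcl d hd x hx (Ne.symm hxd))
    grind
  -- a triangle through a tip contains an end of the chord, as the tip has degree three
  have tip : ∀ x, G.Adj x b → G.Adj x d → x ∈ t → t ⊆ {a, b, c, d} := by
    intro x hxb hxd hx
    obtain ⟨w, -, -, -, hall⟩ := h.exists_third_neighbor hxb hxd hbd.ne
    have hcard : 1 < (t.erase x).card := by
      rw [Finset.card_erase_of_mem hx, ht.card_eq]; norm_num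
    obtain ⟨y, hy, z, hz, hyz⟩ := Finset.one_lt_card.1 hcard
    rw [Finset.mem_erase] at hy hz
    have h1 := hall y (hcl x hx y hy.2 hy.1.symm)
    have h2 := hall z (hcl x hx z hz.2 hz.1.symm)
    grind
  simp only [Finset.mem_insert, Finset.mem_singleton] at hvs
  rcases hvs with rfl | rfl | rfl | rfl
  · exact tip _ hab hda.symm hvt
  · exact hb hvt
  · exact tip _ hbc.symm hcd hvt
  · exact hd hvt

theorem IsRegularOfDegree.diamond_subset_diamond (h : G.IsRegularOfDegree 3)
    {s t : Finset V} (hs : G.IsDiamond s) (ht : G.IsDiamond t) {v : V} (hvs : v ∈ s)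
    (hvt : v ∈ t) : t ⊆ s := by
  obtain ⟨a, b, c, d, hab, hbc, hcd, hda, hbd, hac, rfl⟩ := ht
  have h1 : G.IsNClique 3 {a, b, d} := is3Clique_iff.2 ⟨a, b, d, hab, hda.symm, hbd, rfl⟩
  have h2 : G.IsNClique 3 {b, c, d} := is3Clique_iff.2 ⟨b, c, d, hbc, hbd, hcd, rfl⟩
  have key : ∀ x ∈ s, x ∈ ({a, b, d} : Finset V) ∨ x ∈ ({b, c, d} : Finset V) →
      {a, b, c, d} ⊆ s := by
    rintro x hx (hx' | hx')
    · have h3 := h.triangle_subset_diamond hs h1 hx hx'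
      have h4 := h.triangle_subset_diamond hs h2 (h3 (by simp : b ∈ _)) (by simp)
      grind
    · have h3 := h.triangle_subset_diamond hs h2 hx hx'
      have h4 := h.triangle_subset_diamond hs h1 (h3 (by simp : b ∈ _)) (by simp)
      grind
  exact key v hvs (by grind)

/-- The vertices of a claw-free cubic graph fall into triangles and diamonds. A diamond is
listed as a 4-cycle with the chord between its vertices `1` and `3`. -/
theorem ClawFree.exists_block_partition {V : Type u} [Fintype V] {G : SimpleGraph V}
    [G.LocallyFinite] (hc : G.ClawFree) (h : G.IsRegularOfDegree 3) :
    ∃ (T D : Type u) (_ : Fintype T) (_ : Fintype D) (e : T × Fin 3 ⊕ D × Fin 4 ≃ V),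
      (∀ t i, G.Adj (e (.inl (t, i))) (e (.inl (t, i + 1)))) ∧
      (∀ j k, G.Adj (e (.inr (j, k))) (e (.inr (j, k + 1)))) ∧
      ∀ j, G.Adj (e (.inr (j, 1))) (e (.inr (j, 3))) := by
  classical
  let T := {s : Finset V // G.IsNClique 3 s ∧ ∀ d, G.IsDiamond d → ¬ s ⊆ d}
  let D := {s : Finset V // G.IsDiamond s}
  have hT : ∀ t : T, ∃ g : Fin 3 → V, Function.Injective g ∧ (∀ v, v ∈ t.1 ↔ ∃ i, g i = v) ∧
      ∀ i, G.Adj (g i) (g (i + 1)) := by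
    rintro ⟨s, hs, -⟩
    obtain ⟨a, b, c, hab, hac, hbc, rfl⟩ := is3Clique_iff.1 hs
    refine ⟨![a, b, c], ?_, ?_, ?_⟩
    · have := hab.ne; have := hac.ne; have := hbc.ne
      intro i j hij
      fin_cases i <;> fin_cases j <;> simp_all
    · intro v; simp [Fin.exists_fin_succ, eq_comm]
    · intro i; fin_cases i
      exacts [hab, hbc, hac.symm]
  have hD : ∀ t : D, ∃ g : Fin 4 → V, Function.Injective g ∧ (∀ v, v ∈ t.1 ↔ ∃ i, g i = v) ∧
      (∀ i, G.Adj (g i) (g (i + 1))) ∧ G.Adj (g 1) (g 3) := by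
    rintro ⟨s, a, b, c, d, hab, hbc, hcd, hda, hbd, hac, rfl⟩
    refine ⟨![a, b, c, d], ?_, ?_, ?_, hbd⟩
    · have := hab.ne; have := hbc.ne; have := hcd.ne; have := hda.ne; have := hbd.ne
      intro i j hij
      fin_cases i <;> fin_cases j <;> simp_all
    · intro v; simp [Fin.exists_fin_succ, eq_comm]
    · intro i; fin_cases i
      exacts [hab, hbc, hcd, hda]
  choose g hg hgm hga using hT
  choose f hf hfm hfa hfc using hD
  let e : T × Fin 3 ⊕ D × Fin 4 → V := Sum.elim (fun x => g x.1 x.2) (fun x => f x.1 x.2)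
  have he : Function.Bijective e := by
    constructor
    · have hgf : ∀ t i j k, g t i ≠ f j k := fun t i j k hE => t.2.2 j.1 j.2 <|
        h.triangle_subset_diamond j.2 t.2.1 ((hfm j _).2 ⟨k, rfl⟩) ((hgm t _).2 ⟨i, hE⟩)
      rintro (⟨t, i⟩ | ⟨j, k⟩) (⟨t', i'⟩ | ⟨j', k'⟩) hE
      · simp only [e, Sum.elim_inl] at hE
        obtain rfl : t = t' := Subtype.ext <|
          (h.eq_or_diamond_of_triangles t.2.1 t'.2.1 ((hgm t _).2 ⟨i, rfl⟩)
            ((hgm t' _).2 ⟨i', hE.symm⟩)).resolve_right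
            fun ⟨d, hd, hs⟩ => t.2.2 d hd hs
        rw [hg t hE]
      · exact absurd hE (hgf _ _ _ _)
      · exact absurd hE.symm (hgf _ _ _ _)
      · simp only [e, Sum.elim_inr] at hE
        have h1 : f j k ∈ j.1 := (hfm j _).2 ⟨k, rfl⟩
        have h2 : f j k ∈ j'.1 := (hfm j' _).2 ⟨k', hE.symm⟩
        obtain rfl : j = j' := Subtype.ext <| Finset.Subset.antisymm
          (h.diamond_subset_diamond j'.2 j.2 h2 h1) (h.diamond_subset_diamond j.2 j'.2 h1 h2)
        rw [hf j hE]
    · intro v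
      obtain ⟨p, q, hp, hq, hpq⟩ := hc.exists_triangle h v
      have hs : G.IsNClique 3 {v, p, q} := is3Clique_iff.2 ⟨v, p, q, hp, hq, hpq, rfl⟩
      by_cases hd : ∃ d, G.IsDiamond d ∧ {v, p, q} ⊆ d
      · obtain ⟨d, hd, hsub⟩ := hd
        obtain ⟨k, hk⟩ := (hfm ⟨d, hd⟩ v).1 (hsub (by simp))
        exact ⟨.inr (⟨d, hd⟩, k), hk⟩
      · push Not at hd
        obtain ⟨k, hk⟩ := (hgm ⟨_, hs, hd⟩ v).1 (by simp)
        exact ⟨.inl (⟨_, hs, hd⟩, k), hk⟩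
  exact ⟨T, D, inferInstance, inferInstance, Equiv.ofBijective e he,
    fun t i => hga t i, fun j k => hfa j k, fun j => hfc j⟩

end SimpleGraph

/-! ### Perfect matchings as involutions -/

namespace SimpleGraph

/-- The involutions that send each vertex to a neighbour; these encode perfect matchings. -/
def adjInvolutions {V : Type*} (G : SimpleGraph V) : Set (V → V) :=
  {f | ∀ v, G.Adj v (f v) ∧ f (f v) = v}

theorem ncard_adjInvolutions_le_numPerfectMatchings {V : Type*} [Finite V] (G : SimpleGraph V) :
    G.adjInvolutions.ncard ≤ G.numPerfectMatchings := by
  classical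
  let M : ∀ f, f ∈ G.adjInvolutions → G.Subgraph := fun f hf =>
    { verts := Set.univ
      Adj := fun v w => f v = w
      adj_sub := by rintro v _ rfl; exact (hf v).1
      edge_vert := fun _ => Set.mem_univ _
      symm := ⟨by rintro v _ rfl; exact (hf v).2⟩ }
  refine Set.ncard_le_ncard_of_injOn (fun f => if hf : f ∈ G.adjInvolutions then M f hf else ⊥)
    ?_ ?_ (Set.toFinite _)
  · intro f hf
    simp only [hf, dif_pos, Set.mem_ofPred_eq]
    rw [Subgraph.isPerfectMatching_iff]
    exact fun v => ⟨f v, rfl, fun w (hw : f v = w) => hw.symm⟩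
  · intro f hf g hg hfg
    simp only [hf, hg, dif_pos] at hfg
    have h := congrArg Subgraph.Adj hfg
    funext v
    have h1 : (M f hf).Adj v (f v) := rfl
    rw [h] at h1
    exact Eq.symm (show g v = f v from h1)

/-! ### Graphs made of triangles and diamonds -/

/-- The vertices of a disjoint union of triangles, indexed by `T`, and diamonds, indexed by `D`.
The positions in a diamond follow its 4-cycle; positions `1` and `3` are joined by the chord. -/
abbrev BlockVertex (T D : Type*) := T × Fin 3 ⊕ D × Fin 4

namespace BlockVertex

variable {T D : Type*}

/-- The successor of a vertex in the cyclic order of its block. -/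
def next : BlockVertex T D → BlockVertex T D
  | .inl (t, i) => .inl (t, i + 1)
  | .inr (j, k) => .inr (j, k + 1)

/-- The predecessor of a vertex in the cyclic order of its block. -/
def prev : BlockVertex T D → BlockVertex T D
  | .inl (t, i) => .inl (t, i + 2)
  | .inr (j, k) => .inr (j, k + 3)

/-- The block that contains a vertex. -/
def block : BlockVertex T D → T ⊕ D := Sum.map Prod.fst Prod.fst

@[simp] theorem next_prev (v : BlockVertex T D) : next (prev v) = v := by
  rcases v with ⟨t, i⟩ | ⟨j, k⟩ <;> simp [next, prev, add_assoc]

@[simp] theorem prev_next (v : BlockVertex T D) : prev (next v) = v := by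
  rcases v with ⟨t, i⟩ | ⟨j, k⟩ <;> simp [next, prev, add_assoc]

theorem next_ne_prev (v : BlockVertex T D) : next v ≠ prev v := by
  rcases v with ⟨t, i⟩ | ⟨j, k⟩
  · simp only [next, prev, ne_eq, Sum.inl.injEq, Prod.mk.injEq, true_and]
    revert i; decide
  · simp only [next, prev, ne_eq, Sum.inr.injEq, Prod.mk.injEq, true_and]
    revert k; decide

@[simp] theorem block_next (v : BlockVertex T D) : block (next v) = block v := by
  rcases v with ⟨t, i⟩ | ⟨j, k⟩ <;> rfl

@[simp] theorem block_prev (v : BlockVertex T D) : block (prev v) = block v := by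
  rcases v with ⟨t, i⟩ | ⟨j, k⟩ <;> rfl

@[simp] theorem block_inl (p : T × Fin 3) : block (.inl p : BlockVertex T D) = .inl p.1 := rfl

@[simp] theorem block_inr (p : D × Fin 4) : block (.inr p : BlockVertex T D) = .inr p.1 := rfl

section Sums

variable [Fintype T] [Fintype D] [DecidableEq T] [DecidableEq D]

theorem sum_block_inl (x : BlockVertex T D → ZMod 2) (t : T) :
    ∑ v with block v = .inl t, x v = x (.inl (t, 0)) + x (.inl (t, 1)) + x (.inl (t, 2)) := by
  rw [Finset.sum_filter, Fintype.sum_sum_type, Fintype.sum_prod_type, Fintype.sum_prod_type]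
  simp [Fin.sum_univ_three]

theorem sum_block_inr (x : BlockVertex T D → ZMod 2) (j : D) :
    ∑ v with block v = .inr j, x v =
      x (.inr (j, 0)) + x (.inr (j, 1)) + x (.inr (j, 2)) + x (.inr (j, 3)) := by
  rw [Finset.sum_filter, Fintype.sum_sum_type, Fintype.sum_prod_type, Fintype.sum_prod_type]
  simp [Fin.sum_univ_four]

theorem sum_block_single (u : BlockVertex T D) (B : T ⊕ D) :
    ∑ v with block v = B, (Pi.single u 1 : _ → ZMod 2) v = if block u = B then 1 else 0 := by
  simp [Pi.single_apply]

end Sums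

end BlockVertex

open BlockVertex

/-- The edges of the cubic graph `G` are those of the cyclic orders of the blocks together with
the perfect matching `v ↦ σ v`, which contains the chord of each diamond. -/
structure IsBlockMatching {T D : Type*} (G : SimpleGraph (BlockVertex T D))
    (σ : BlockVertex T D → BlockVertex T D) : Prop where
  adj_next : ∀ v, G.Adj v (next v)
  adj_matching : ∀ v, G.Adj v (σ v)
  ne_next : ∀ v, σ v ≠ next v
  ne_prev : ∀ v, σ v ≠ prev v
  eq_of_adj : ∀ v w, G.Adj v w → w = next v ∨ w = prev v ∨ w = σ v
  matching_matching : ∀ v, σ (σ v) = v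
  chord : ∀ j, σ (.inr (j, 1)) = .inr (j, 3)

namespace IsBlockMatching

variable {T D : Type*} {G : SimpleGraph (BlockVertex T D)} {σ : BlockVertex T D → BlockVertex T D}

theorem matching_eq_iff (h : G.IsBlockMatching σ) {u v : BlockVertex T D} :
    σ u = v ↔ u = σ v :=
  ⟨fun e => by rw [← e, h.matching_matching], fun e => by rw [e, h.matching_matching]⟩

theorem adj_prev (h : G.IsBlockMatching σ) (v : BlockVertex T D) :
    G.Adj v (prev v) := by
  have := (h.adj_next (prev v)).symm
  rwa [next_prev] at this

theorem chord_symm (h : G.IsBlockMatching σ) (j : D) : σ (.inr (j, 3)) = .inr (j, 1) := by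
  rw [← h.chord, h.matching_matching]

end IsBlockMatching

/-- If the blocks are joined by their cycles and chords and each vertex has exactly one neighbour
besides its neighbours on the cycle, then these third neighbours form a perfect matching. -/
theorem exists_isBlockMatching {T D : Type*} {G : SimpleGraph (BlockVertex T D)}
    (hnext : ∀ v, G.Adj v (next v)) (hchord : ∀ j, G.Adj (.inr (j, 1)) (.inr (j, 3)))
    (hthird : ∀ v p q, G.Adj v p → G.Adj v q → p ≠ q →
      ∃ w, G.Adj v w ∧ w ≠ p ∧ w ≠ q ∧ ∀ x, G.Adj v x → x = p ∨ x = q ∨ x = w) :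
    ∃ σ, G.IsBlockMatching σ := by
  have hprev : ∀ v, G.Adj v (prev v) := fun v => by
    have := (hnext (prev v)).symm
    rwa [next_prev] at this
  choose σ h1 h2 h3 h4 using fun v =>
    hthird v (next v) (prev v) (hnext v) (hprev v) (next_ne_prev v)
  refine ⟨σ, hnext, h1, h2, h3, h4, fun v => ?_, fun j => ?_⟩
  · rcases h4 (σ v) v (h1 v).symm with h | h | h
    · exact absurd ((congrArg prev h).trans (prev_next _)).symm (h3 v)
    · exact absurd ((congrArg next h).trans (next_prev _)).symm (h2 v)
    · exact h.symm
  · rcases h4 _ _ (hchord j) with h | h | h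
    · simp [next] at h
    · simp [prev] at h
    · exact h.symm

/-! ### The space of even subgraphs -/

/-- The even edge sets in the graph obtained by contracting each block, as a vector space over
`ZMod 2`. Such a set of edges of the matching `σ` is encoded by its indicator function `z` on the
vertices. Evenness at a diamond says that `z` agrees on the two tips; since the chord of a diamond
carries no information, `z` is required to be constant on each diamond. -/
def evenSpace {T D : Type*} (σ : BlockVertex T D → BlockVertex T D) :
    Submodule (ZMod 2) (BlockVertex T D → ZMod 2) where
  carrier := {z | (∀ v, z (σ v) = z v) ∧
    (∀ t, z (.inl (t, 0)) + z (.inl (t, 1)) + z (.inl (t, 2)) = 0) ∧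
    ∀ j k, z (.inr (j, k)) = z (.inr (j, 0))}
  add_mem' := by
    rintro y z ⟨h1, h2, h3⟩ ⟨h1', h2', h3'⟩
    refine ⟨fun v => by simp [h1, h1'], fun t => ?_, fun j k => by
      simp only [Pi.add_apply]; rw [h3, h3']⟩
    simp only [Pi.add_apply]
    linear_combination h2 t + h2' t
  zero_mem' := by simp
  smul_mem' := by
    rintro c z ⟨h1, h2, h3⟩
    refine ⟨fun v => by simp [h1], fun t => ?_, fun j k => by
      simp only [Pi.smul_apply]; rw [h3]⟩
    simp only [Pi.smul_apply, smul_eq_mul]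
    linear_combination c * h2 t

section

variable {T D : Type*} {G : SimpleGraph (BlockVertex T D)}
  {σ : BlockVertex T D → BlockVertex T D}

/-- The functions invariant under `σ` have at least half the dimension of all functions, and each
triangle imposes one linear condition on them and each diamond two. -/
theorem IsBlockMatching.card_le_two_mul_finrank_evenSpace [Fintype T] [Fintype D]
    (h : G.IsBlockMatching σ) :
    Fintype.card T ≤ 2 * Module.finrank (ZMod 2) (evenSpace σ) := by
  let A : (BlockVertex T D → ZMod 2) →ₗ[ZMod 2] (BlockVertex T D → ZMod 2) :=
    LinearMap.id + LinearMap.funLeft (ZMod 2) (ZMod 2) σ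
  let C : (BlockVertex T D → ZMod 2) →ₗ[ZMod 2]
      (T → ZMod 2) × (D → ZMod 2) × (D → ZMod 2) :=
    { toFun := fun y => (fun t => y (.inl (t, 0)) + y (.inl (t, 1)) + y (.inl (t, 2)),
        fun j => y (.inr (j, 0)) + y (.inr (j, 1)), fun j => y (.inr (j, 0)) + y (.inr (j, 2)))
      map_add' := fun y z => by
        ext <;> simp <;> ring
      map_smul' := fun c y => by
        ext <;> simp <;> ring }
  have hA : ∀ y, y ∈ LinearMap.ker A ↔ ∀ v, y (σ v) = y v := fun y => by
    rw [LinearMap.mem_ker, funext_iff]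
    refine forall_congr' fun v => ?_
    simp only [A, LinearMap.add_apply, LinearMap.id_apply, Pi.add_apply, LinearMap.funLeft_apply,
      Pi.zero_apply, CharTwo.add_eq_zero]
    exact eq_comm
  have hle : LinearMap.ker A ⊓ LinearMap.ker C ≤ evenSpace σ := by
    rintro y ⟨h1, h2⟩
    replace h1 := (hA y).1 h1
    obtain ⟨h3, h4, h5⟩ := by simpa [C, funext_iff, CharTwo.add_eq_zero] using h2
    refine ⟨h1, fun t => ?_, fun j k => ?_⟩
    · rw [h3 t, CharTwo.add_self_eq_zero]
    · fin_cases k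
      · rfl
      · exact (h4 j).symm
      · exact (h5 j).symm
      · exact ((h.chord j ▸ h1 (.inr (j, 1))).trans (h4 j).symm)
  have hAA : LinearMap.range A ≤ LinearMap.ker A := by
    rintro _ ⟨y, rfl⟩
    rw [hA]
    intro v
    simp [A, LinearMap.funLeft_apply, h.matching_matching, add_comm]
  have e1 := A.finrank_range_add_finrank_ker
  have e2 := C.finrank_range_add_finrank_ker
  have e3 := Submodule.finrank_sup_add_finrank_inf_eq (LinearMap.ker A) (LinearMap.ker C)
  have i1 := Submodule.finrank_mono hAA
  have i2 := Submodule.finrank_le (LinearMap.range C)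
  have i3 := Submodule.finrank_le (LinearMap.ker A ⊔ LinearMap.ker C)
  have i4 := Submodule.finrank_mono hle
  have hY : Module.finrank (ZMod 2) (BlockVertex T D → ZMod 2) = Fintype.card T * 3 + Fintype.card D * 4 := by
    simp
  simp only [Module.finrank_prod, Module.finrank_fintype_fun_eq_card] at i2
  omega

/-- The matching edges traversed an odd number of times by a walk from `a` to `w` meet each block
an even number of times, except for the blocks of `a` and `w` if these differ. Here the walk avoids
the matching edge at `a`. -/
theorem IsBlockMatching.exists_of_reachable [Fintype T] [Fintype D] [DecidableEq T]
    [DecidableEq D] (h : G.IsBlockMatching σ) {a w : BlockVertex T D}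
    (hr : (G.deleteEdges {s(a, σ a)}).Reachable a w) :
    ∃ y : BlockVertex T D → ZMod 2, (∀ v, y (σ v) = y v) ∧ y a = 0 ∧
      ∀ B, ∑ v with block v = B, y v =
        (if block a = B then 1 else 0) + if block w = B then 1 else 0 := by
  rw [reachable_iff_reflTransGen] at hr
  induction hr with
  | refl => exact ⟨0, by simp, by simp, fun B => by simp [CharTwo.add_self_eq_zero]⟩
  | @tail w x _ hwx ih =>
    obtain ⟨y, hy1, hy2, hy3⟩ := ih
    rw [deleteEdges_adj] at hwx
    obtain ⟨hadj, hne⟩ := hwx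
    rcases h.eq_of_adj _ _ hadj with rfl | rfl | rfl
    · exact ⟨y, hy1, hy2, by simpa using hy3⟩
    · exact ⟨y, hy1, hy2, by simpa using hy3⟩
    · refine ⟨y + Pi.single w 1 + Pi.single (σ w) 1, fun v => ?_, ?_, fun B => ?_⟩
      · simp only [Pi.add_apply, Pi.single_apply, hy1, h.matching_eq_iff, h.matching_matching]
        ring
      · have h1 : a ≠ w := by rintro rfl; exact hne rfl
        have h2 : a ≠ σ w := by
          rintro rfl
          rw [h.matching_matching] at hne
          exact hne Sym2.eq_swap
        simp [hy2, h1, h2]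
      · simp only [Pi.add_apply, Finset.sum_add_distrib, sum_block_single, hy3]
        rw [add_assoc, add_assoc, ← add_assoc (if block w = B then (1 : ZMod 2) else 0),
          CharTwo.add_self_eq_zero, zero_add]

/-- As the matching edge at `a` is not a cutedge, some even edge set contains it. -/
theorem IsBlockMatching.exists_mem_evenSpace_eq_one [Fintype T] [Fintype D]
    (h : G.IsBlockMatching σ) (hcut : ∀ a, (G.deleteEdges {s(a, σ a)}).Reachable a (σ a)) (j : D) :
    ∃ z ∈ evenSpace σ, z (.inr (j, 0)) = 1 := by
  classical
  obtain ⟨y, hy1, hy2, hy3⟩ := h.exists_of_reachable (hcut (.inr (j, 0)))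
  set a : BlockVertex T D := .inr (j, 0) with ha
  -- the edge at `a` closes the walk
  let x := y + Pi.single a 1 + Pi.single (σ a) 1
  have hx1 : ∀ v, x (σ v) = x v := fun v => by
    simp only [x, Pi.add_apply, Pi.single_apply, hy1, h.matching_eq_iff, h.matching_matching]
    ring
  have hx2 : x a = 1 := by simp [x, hy2, (h.adj_matching a).ne]
  have hx3 : ∀ B, ∑ v with block v = B, x v = 0 := fun B => by
    simp only [x, Pi.add_apply, Finset.sum_add_distrib, sum_block_single, hy3]
    linear_combination CharTwo.add_self_eq_zero (if block a = B then (1 : ZMod 2) else 0) +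
      CharTwo.add_self_eq_zero (if block (σ a) = B then (1 : ZMod 2) else 0)
  have hT : ∀ t, x (.inl (t, 0)) + x (.inl (t, 1)) + x (.inl (t, 2)) = 0 := fun t => by
    rw [← sum_block_inl, hx3]
  have hD : ∀ j, x (.inr (j, 2)) = x (.inr (j, 0)) := fun j => by
    have h1 := hx3 (.inr j)
    have h2 := hx1 (.inr (j, 1))
    rw [h.chord] at h2
    rw [sum_block_inr, h2] at h1
    rw [← CharTwo.add_eq_zero]
    linear_combination h1 - CharTwo.add_self_eq_zero (x (.inr (j, 1)))
  refine ⟨Sum.elim (fun p => x (.inl p)) (fun p => x (.inr (p.1, 0))), ⟨?_, hT, fun j k => rfl⟩, hx2⟩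
  -- away from the chords the new function agrees with `x`
  have hz : ∀ v, (∀ j, v ≠ .inr (j, 1) ∧ v ≠ .inr (j, 3)) →
      Sum.elim (fun p => x (.inl p)) (fun p => x (.inr (p.1, 0))) v = x v := by
    rintro (p | ⟨j, k⟩) hv
    · rfl
    · have := hv j
      fin_cases k
      · rfl
      · simp at this
      · exact (hD j).symm
      · simp at this
  intro v
  by_cases hv : ∃ j, v = .inr (j, 1) ∨ v = .inr (j, 3)
  · obtain ⟨j, rfl | rfl⟩ := hv
    · rw [h.chord]; rfl
    · rw [h.chord_symm]; rfl
  · push Not at hv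
    rw [hz v hv, hz (σ v), hx1]
    intro j
    rw [Ne, Ne, h.matching_eq_iff, h.matching_eq_iff, h.chord, h.chord_symm]
    exact (hv j).symm

end

/-! ### Perfect matchings from even subgraphs -/

section

variable {T D : Type*} [DecidableEq D] {G : SimpleGraph (BlockVertex T D)}
  {σ : BlockVertex T D → BlockVertex T D}

/-- The perfect matching obtained from `σ` by giving up the edges of the even set `z`. In a triangle
the two vertices concerned are matched with each other. A diamond with `z = 1` is matched along its
4-cycle, in one of two ways according to whether it belongs to `S`. -/
def reroute (σ : BlockVertex T D → BlockVertex T D) (z : BlockVertex T D → ZMod 2)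
    (S : Finset D) : BlockVertex T D → BlockVertex T D
  | .inl (t, i) => if z (.inl (t, i)) = 0 then σ (.inl (t, i)) else
      if z (.inl (t, i + 1)) = 1 then .inl (t, i + 1) else .inl (t, i + 2)
  | .inr (j, k) => if z (.inr (j, k)) = 0 then σ (.inr (j, k)) else
      if (k.val % 2 = 0 ↔ j ∈ S) then .inr (j, k + 1) else .inr (j, k + 3)

theorem reroute_of_eq_zero {z : BlockVertex T D → ZMod 2} {S : Finset D} {v : BlockVertex T D}
    (hv : z v = 0) : reroute σ z S v = σ v := by
  rcases v with ⟨t, i⟩ | ⟨j, k⟩ <;> simp [reroute, hv]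

theorem reroute_of_ne_zero {z : BlockVertex T D → ZMod 2} {S : Finset D} {v : BlockVertex T D}
    (hv : z v ≠ 0) : reroute σ z S v = next v ∨ reroute σ z S v = prev v := by
  rcases v with ⟨t, i⟩ | ⟨j, k⟩
  · simp only [reroute, hv, if_false, next, prev]
    split_ifs <;> simp
  · simp only [reroute, hv, if_false, next, prev]
    split_ifs <;> simp

theorem IsBlockMatching.reroute_mem (h : G.IsBlockMatching σ) {z : BlockVertex T D → ZMod 2}
    (hz : z ∈ evenSpace σ) (S : Finset D) : reroute σ z S ∈ G.adjInvolutions := by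
  obtain ⟨h1, h2, h3⟩ := hz
  intro v
  by_cases hv : z v = 0
  · rw [reroute_of_eq_zero hv, reroute_of_eq_zero ((h1 v).trans hv)]
    exact ⟨h.adj_matching v, h.matching_matching v⟩
  · refine ⟨?_, ?_⟩
    · rcases reroute_of_ne_zero (σ := σ) (S := S) hv with e | e <;> rw [e]
      exacts [h.adj_next v, h.adj_prev v]
    · have key : ∀ a : ZMod 2, a ≠ 0 ↔ a = 1 := by decide
      rw [← Ne, key] at hv
      rcases v with ⟨t, i⟩ | ⟨j, k⟩
      · have h4 := h2 t
        have key2 : ∀ a : ZMod 2, a = 0 ∨ a = 1 := by decide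
        rcases key2 (z (.inl (t, 0))) with h0 | h0 <;> rcases key2 (z (.inl (t, 1))) with h1 | h1 <;>
          rcases key2 (z (.inl (t, 2))) with h2 | h2 <;> rw [h0, h1, h2] at h4 <;>
          first
          | exact absurd h4 (by decide)
          | (fin_cases i <;> simp_all [reroute])
      · have h4 : ∀ k, z (.inr (j, k)) ≠ 0 := fun k' => by rw [key, h3, ← h3 j k, hv]
        by_cases hj : j ∈ S <;> fin_cases k <;> simp [reroute, h4, hj]

theorem IsBlockMatching.reroute_injective (h : G.IsBlockMatching σ)
    {z z' : BlockVertex T D → ZMod 2} {S S' : Finset D}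
    (hS : ∀ j ∈ S, z (.inr (j, 0)) = 1) (hS' : ∀ j ∈ S', z' (.inr (j, 0)) = 1)
    (he : reroute σ z S = reroute σ z' S') : z = z' ∧ S = S' := by
  -- the vertices where `z` vanishes are those that stay matched along `σ`
  have h0 : ∀ z S v, reroute σ z S v = σ v ↔ z v = 0 := fun z S v => by
    refine ⟨fun e => ?_, reroute_of_eq_zero⟩
    by_contra hv
    rcases reroute_of_ne_zero (σ := σ) (S := S) hv with e' | e' <;> rw [e] at e'
    exacts [h.ne_next v e', h.ne_prev v e']
  obtain rfl : z = z' := by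
    funext v
    have h1 : z v = 0 ↔ z' v = 0 := by rw [← h0 z S, ← h0 z' S', he]
    have key : ∀ a b : ZMod 2, (a = 0 ↔ b = 0) → a = b := by decide
    exact key _ _ h1
  refine ⟨rfl, Finset.ext fun j => ?_⟩
  by_cases hj : z (.inr (j, 0)) = 1
  · have h1 := congrFun he (.inr (j, 0))
    by_cases hjS : j ∈ S <;> by_cases hjS' : j ∈ S' <;> simp_all [reroute]
  · exact ⟨fun hm => absurd (hS j hm) hj, fun hm => absurd (hS' j hm) hj⟩

/-- Each even edge set `z` yields a perfect matching for every set of diamonds on which `z` is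
not zero. -/
theorem IsBlockMatching.sum_two_pow_le [Fintype T] [Fintype D] (h : G.IsBlockMatching σ)
    [Fintype (evenSpace σ)] :
    ∑ z : evenSpace σ, 2 ^ (Finset.univ.filter fun j => z.1 (.inr (j, 0)) = 1).card ≤
      G.adjInvolutions.ncard := by
  classical
  let U : evenSpace σ → Finset D := fun z => Finset.univ.filter fun j => z.1 (.inr (j, 0)) = 1
  have hcard : Fintype.card (Σ z : evenSpace σ, (U z).powerset) = ∑ z, 2 ^ (U z).card := by
    simp only [Fintype.card_sigma, Fintype.card_coe, Finset.card_powerset]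
  have hmem : ∀ x : Σ z : evenSpace σ, (U z).powerset, ∀ j ∈ x.2.1, x.1.1 (.inr (j, 0)) = 1 := by
    rintro ⟨z, S, hS⟩ j hj
    exact (Finset.mem_filter.1 (Finset.mem_powerset.1 hS hj)).2
  rw [← hcard, ← Nat.card_eq_fintype_card, ← Nat.card_coe_set_eq]
  refine Nat.card_le_card_of_injective
    (fun x => ⟨reroute σ x.1.1 x.2.1, h.reroute_mem x.1.2 _⟩) ?_
  intro x y hxy
  obtain ⟨h1, h2⟩ := h.reroute_injective (hmem x) (hmem y) (congrArg Subtype.val hxy)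
  rcases x with ⟨⟨z, hz⟩, S, hS⟩
  rcases y with ⟨⟨z', hz'⟩, S', hS'⟩
  obtain rfl : z = z' := h1
  obtain rfl : S = S' := h2
  rfl

end

/-! ### Averaging over even subgraphs -/

/-- Jensen's inequality for `x ↦ 2 ^ x`. -/
theorem card_mul_two_rpow_le_sum {ι : Type*} [Fintype ι] (u : ι → ℝ) (m : ℝ)
    (h : ∑ i, u i = Fintype.card ι * m) :
    Fintype.card ι * (2 : ℝ) ^ m ≤ ∑ i, (2 : ℝ) ^ u i := by
  have key : ∀ x : ℝ, (2 : ℝ) ^ m * (1 + (x - m) * Real.log 2) ≤ (2 : ℝ) ^ x := fun x => by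
    have h1 := Real.add_one_le_exp ((x - m) * Real.log 2)
    have h2 : (2 : ℝ) ^ x = (2 : ℝ) ^ m * Real.exp ((x - m) * Real.log 2) := by
      rw [mul_comm (x - m), ← Real.rpow_def_of_pos two_pos, ← Real.rpow_add two_pos]
      ring_nf
    rw [h2]
    exact mul_le_mul_of_nonneg_left (by linarith) (by positivity)
  refine le_trans (le_of_eq ?_) (Finset.sum_le_sum fun i _ => key (u i))
  rw [← Finset.mul_sum, Finset.sum_add_distrib, ← Finset.sum_mul, Finset.sum_sub_distrib, h]
  simp
  ring

section

variable {T D : Type*} [Fintype T] [Fintype D] {G : SimpleGraph (BlockVertex T D)}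
  {σ : BlockVertex T D → BlockVertex T D}

/-- As no edge is a cutedge, a given diamond is met by exactly half of the even edge sets. -/
theorem IsBlockMatching.two_mul_sum_eq_card (h : G.IsBlockMatching σ)
    (hcut : ∀ a, (G.deleteEdges {s(a, σ a)}).Reachable a (σ a)) [Fintype (evenSpace σ)] (j : D) :
    2 * ∑ z : evenSpace σ, (if z.1 (.inr (j, 0)) = 1 then (1 : ℝ) else 0) =
      Fintype.card (evenSpace σ) := by
  obtain ⟨z₀, hz₀, hj⟩ := h.exists_mem_evenSpace_eq_one hcut j
  have h1 := Equiv.sum_comp (Equiv.addRight (⟨z₀, hz₀⟩ : evenSpace σ))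
    fun z : evenSpace σ => if z.1 (.inr (j, 0)) = 1 then (1 : ℝ) else 0
  have h2 : ∀ a : ZMod 2, (if a + 1 = 1 then (1 : ℝ) else 0) + (if a = 1 then 1 else 0) = 1 := by
    intro a
    obtain rfl | rfl : a = 0 ∨ a = 1 := by revert a; decide
    · simp
    · simp
  rw [two_mul]
  nth_rewrite 1 [← h1]
  rw [← Finset.sum_add_distrib, Finset.sum_congr rfl (g := fun _ => (1 : ℝ))]
  · simp
  · intro z _
    simpa [hj] using h2 (z.1 (.inr (j, 0)))

theorem IsBlockMatching.two_rpow_le_ncard (h : G.IsBlockMatching σ)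
    (hcut : ∀ a, (G.deleteEdges {s(a, σ a)}).Reachable a (σ a)) :
    (2 : ℝ) ^ ((Fintype.card T + Fintype.card D : ℝ) / 2) ≤ G.adjInvolutions.ncard := by
  classical
  have : Fintype (evenSpace σ) := Fintype.ofFinite _
  have h1 : ∑ z : evenSpace σ,
      ((Finset.univ.filter fun j => z.1 (.inr (j, 0)) = 1).card : ℝ) =
        Fintype.card (evenSpace σ) * ((Fintype.card D : ℝ) / 2) := by
    have h2 := Finset.sum_congr (s₁ := (Finset.univ : Finset D)) rfl
      fun j _ => h.two_mul_sum_eq_card hcut j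
    rw [← Finset.mul_sum, Finset.sum_comm] at h2
    simp only [Finset.sum_boole, Finset.sum_const, Finset.card_univ, nsmul_eq_mul] at h2
    linarith
  have h3 := card_mul_two_rpow_le_sum _ _ h1
  have h4 : ∑ z : evenSpace σ, (2 : ℝ) ^
      ((Finset.univ.filter fun j => z.1 (.inr (j, 0)) = 1).card : ℝ) ≤
        G.adjInvolutions.ncard := by
    simp only [Real.rpow_natCast]
    exact_mod_cast h.sum_two_pow_le
  have h5 : (2 : ℝ) ^ ((Fintype.card T : ℝ) / 2) ≤ Fintype.card (evenSpace σ) := by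
    rw [Module.card_eq_pow_finrank (K := ZMod 2) (V := evenSpace σ), ZMod.card, Nat.cast_pow,
      ← Real.rpow_natCast, Nat.cast_two]
    refine Real.rpow_le_rpow_of_exponent_le one_le_two ?_
    have : (Fintype.card T : ℝ) ≤ 2 * (Module.finrank (ZMod 2) (evenSpace σ) : ℝ) := by
      exact_mod_cast h.card_le_two_mul_finrank_evenSpace
    linarith
  rw [add_div, Real.rpow_add two_pos]
  exact (mul_le_mul_of_nonneg_right h5 (by positivity)).trans (h3.trans h4)

end

end SimpleGraph

theorem mainTheorem2 {V : Type*} [Fintype V] [Nonempty V] (G : SimpleGraph V)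
    [G.LocallyFinite] (hclaw : G.ClawFree) (hcubic : G.IsRegularOfDegree 3)
    (hcut : G.NoCutedge) :
    (2 : ℝ) ^ ((Fintype.card V : ℝ) / 12) < (G.numPerfectMatchings : ℝ) := by
  obtain ⟨T, D, _, _, e, he1, he2, he3⟩ := hclaw.exists_block_partition hcubic
  let H : SimpleGraph (BlockVertex T D) := G.comap e
  obtain ⟨σ, hσ⟩ : ∃ σ, H.IsBlockMatching σ := by
    refine exists_isBlockMatching ?_ he3 ?_
    · rintro (⟨t, i⟩ | ⟨j, k⟩)
      exacts [he1 t i, he2 j k]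
    · intro v p q hp hq hpq
      obtain ⟨w, hw, hwp, hwq, hall⟩ :=
        hcubic.exists_third_neighbor (v := e v) hp hq (e.injective.ne hpq)
      refine ⟨e.symm w, ?_, ?_, ?_, fun x hx => ?_⟩
      · simpa [H] using hw
      · rwa [Ne, e.symm_apply_eq]
      · rwa [Ne, e.symm_apply_eq]
      · rw [e.eq_symm_apply]
        exact (hall _ hx).imp (e.injective ·) (Or.imp_left (e.injective ·))
  have hHcut : ∀ a, (H.deleteEdges {s(a, σ a)}).Reachable a (σ a) := fun a => by
    have h1 : ¬ G.IsBridge s(e a, e (σ a)) := hcut _ (hσ.adj_matching a)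
    rw [isBridge_iff, not_not] at h1
    let φ : G.deleteEdges {s(e a, e (σ a))} →g H.deleteEdges {s(a, σ a)} :=
      { toFun := e.symm
        map_rel' := by
          intro x y hxy
          rw [deleteEdges_adj] at hxy ⊢
          refine ⟨by simpa [H] using hxy.1, fun h2 => hxy.2 ?_⟩
          have h3 := congrArg (Sym2.map e) (Set.mem_singleton_iff.1 h2)
          simpa using h3 }
    simpa [φ] using h1.map φ
  -- conjugation by `e` turns matchings of `H` into matchings of `G`
  have hle : H.adjInvolutions.ncard ≤ G.numPerfectMatchings := by
    refine le_trans ?_ G.ncard_adjInvolutions_le_numPerfectMatchings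
    refine Set.ncard_le_ncard_of_injOn (fun f => e ∘ f ∘ e.symm) ?_ ?_ (Set.toFinite _)
    · intro f hf v
      have := hf (e.symm v)
      simpa [H, ← e.eq_symm_apply] using this
    · intro f _ g _ hfg
      funext v
      simpa using congrFun hfg (e v)
  have hcard : (Fintype.card V : ℝ) = 3 * Fintype.card T + 4 * Fintype.card D := by
    rw [← Fintype.card_congr e]
    simp [mul_comm]
  have hpos : (0 : ℝ) < Fintype.card V := by exact_mod_cast Fintype.card_pos
  refine lt_of_lt_of_le ?_ ((hσ.two_rpow_le_ncard hHcut).trans (by exact_mod_cast hle))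
  refine Real.rpow_lt_rpow_of_exponent_lt one_lt_two ?_
  rw [hcard] at hpos ⊢
  have h1 : (0 : ℝ) ≤ Fintype.card T := Nat.cast_nonneg _
  have h2 : (0 : ℝ) ≤ Fintype.card D := Nat.cast_nonneg _
  linarith
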